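/- Let $T>0$ and let $V_1,V_2\in L^2[0,T)$ be real-valued potentials. For a real-valued $V\in L^2[0,T)$ and $E\in\mathbb{C}$, let $A^E(V)$ denote the transfer matrix of $V$ over $[0,T)$ at energy $E$, that is, the unique matrix in $\mathrm{SL}(2,\mathbb{C})$ such that $$\begin{bmatrix}\psi(T)\\ \psi'(T)\end{bmatrix}=A^E(V)\begin{bmatrix}\psi(0)\\ \psi'(0)\end{bmatrix}$$ for every $\psi:[0,T]\to\mathbb{C}$ such that $\psi$ is differentiable on $[0,T]$ (one-sidedly at the end points), $\psi'$ is absolutely continuous on $[0,T]$, and $-\psi''+V\psi=E\psi$ almost everywhere. If $$A^E(V_1)=A^E(V_2)\quad\text{for every }E\in\mathbb{C},$$ then $V_1=V_2$ Lebesgue almost everywhere on $[0,T)$. -/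

import Mathlib

open MeasureTheory Set
open scoped Matrix

/-- `ψ`, with derivative `φ`, solves the Schrödinger equation `-ψ'' + V ψ = E ψ` on `[0, T]`:
`ψ` is differentiable on `[0, T]` with derivative `φ` (one-sided at the end points),
`φ` is absolutely continuous on `[0, T]`, and `-φ' + V ψ = E ψ` holds at almost every point. -/
structure IsSchrodingerSolution (T : ℝ) (V : ℝ → ℝ) (E : ℂ) (ψ φ : ℝ → ℂ) : Prop where
  hasDeriv : ∀ x ∈ Icc 0 T, HasDerivWithinAt ψ (φ x) (Icc 0 T) x
  absCont : AbsolutelyContinuousOnInterval φ 0 T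
  eqn : ∀ᵐ x : ℝ, x ∈ Ioo 0 T → ∃ d : ℂ, HasDerivAt φ d x ∧ -d + V x * ψ x = E * ψ x

/-- `A` maps the Cauchy data `(ψ(0), ψ'(0))` of every solution of `-ψ'' + V ψ = E ψ` on `[0, T]`
to the Cauchy data `(ψ(T), ψ'(T))`. -/
def IsTransferMatrix (T : ℝ) (V : ℝ → ℝ) (E : ℂ)
    (A : Matrix.SpecialLinearGroup (Fin 2) ℂ) : Prop :=
  ∀ ψ φ : ℝ → ℂ, IsSchrodingerSolution T V E ψ φ →
    ![ψ T, φ T] = (A : Matrix (Fin 2) (Fin 2) ℂ) *ᵥ ![ψ 0, φ 0]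

/-- A complex primitive of an integrable function is absolutely continuous. -/
lemma absolutelyContinuous_primitive {f : ℝ → ℂ} (hf : Integrable f) (c : ℂ) (T : ℝ) :
    AbsolutelyContinuousOnInterval (fun x ↦ c + ∫ t in (0 : ℝ)..x, f t) 0 T := by
  have hconst : ∀ z : ℂ, AbsolutelyContinuousOnInterval (fun _ : ℝ ↦ z) 0 T := fun z ↦
    (contDiff_const.contDiffOn).absolutelyContinuousOnInterval
  have hre : IntervalIntegrable (fun t ↦ (f t).re) volume 0 T := hf.re.intervalIntegrable
  have him : IntervalIntegrable (fun t ↦ (f t).im) volume 0 T := hf.im.intervalIntegrable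
  have h1 := (hre.absolutelyContinuousOnInterval_intervalIntegral
    (c := 0) (by simp)).fun_smul (hconst 1)
  have h2 := (him.absolutelyContinuousOnInterval_intervalIntegral
    (c := 0) (by simp)).fun_smul (hconst Complex.I)
  have h3 := (hconst c).fun_add (h1.fun_add h2)
  refine cast (congrArg (fun F ↦ AbsolutelyContinuousOnInterval F 0 T) (funext fun x ↦ ?_)) h3
  have hfx : IntervalIntegrable f volume 0 x := hf.intervalIntegrable
  have e1 := Complex.reCLM.intervalIntegral_comp_comm hfx
  have e2 := Complex.imCLM.intervalIntegral_comp_comm hfx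
  simp only [Complex.reCLM_apply, Complex.imCLM_apply] at e1 e2
  rw [e1, e2]
  simp

/-- Existence of a solution of the integrated equation, by contraction in a weighted norm. -/
lemma exists_integral_solution {T : ℝ} (hT : 0 < T) {g : ℝ → ℂ} (hg : Integrable g) (a b : ℂ) :
    ∃ u : ℝ → ℂ, Continuous u ∧ Integrable (fun s ↦ g s * u s) ∧ ∀ x ∈ Icc 0 T,
      u x = a + ∫ t in (0 : ℝ)..x, (b + ∫ s in (0 : ℝ)..t, g s * u s) := by
  set G : ℝ := ∫ s, ‖g s‖ with hG
  have hG0 : 0 ≤ G := integral_nonneg fun _ ↦ norm_nonneg _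
  set l : ℝ := 2 * G + 1 with hl
  have hl0 : 0 < l := by positivity
  let w : C(Icc 0 T, ℂ) → ℝ → ℂ := fun v s ↦
    (Real.exp (l * (projIcc 0 T hT.le s : ℝ)) : ℂ) * v (projIcc 0 T hT.le s)
  have hwc : ∀ v, Continuous (w v) := fun v ↦ by
    have := continuous_projIcc (a := 0) (b := T) (h := hT.le)
    fun_prop
  have hgw : ∀ v, Integrable (fun s ↦ g s * w v s) := fun v ↦ by
    refine hg.mul_bdd (c := Real.exp (l * T) * ‖v‖) (hwc v).aestronglyMeasurable (.of_forall fun s ↦ ?_)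
    rw [norm_mul, Complex.norm_real, Real.norm_of_nonneg (Real.exp_pos _).le]
    have := (projIcc 0 T hT.le s).2.2
    gcongr
    exact v.norm_coe_le_norm _
  have hin : ∀ v, Continuous fun t ↦ b + ∫ s in (0 : ℝ)..t, g s * w v s := fun v ↦
    continuous_const.add
      (intervalIntegral.continuous_primitive (fun _ _ ↦ (hgw v).intervalIntegrable) 0)
  have hout : ∀ v, Continuous fun x ↦
      a + ∫ t in (0 : ℝ)..x, (b + ∫ s in (0 : ℝ)..t, g s * w v s) := fun v ↦
    continuous_const.add
      (intervalIntegral.continuous_primitive (fun _ _ ↦ (hin v).intervalIntegrable _ _) 0)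
  let F : C(Icc 0 T, ℂ) → C(Icc 0 T, ℂ) := fun v ↦
    ⟨fun x ↦ (Real.exp (-(l * (x : ℝ))) : ℂ) *
      (a + ∫ t in (0 : ℝ)..x, (b + ∫ s in (0 : ℝ)..t, g s * w v s)), by
      exact Continuous.mul (by fun_prop) ((hout v).comp continuous_subtype_val)⟩
  have hF : ContractingWith (1 / 2) F := by
    refine ⟨by rw [← NNReal.coe_lt_coe]; norm_num, LipschitzWith.of_dist_le_mul fun v₁ v₂ ↦ ?_⟩
    rw [ContinuousMap.dist_le (by positivity)]
    intro x
    set D := dist v₁ v₂ with hD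
    have hD0 : 0 ≤ D := dist_nonneg
    have hwd : ∀ t ∈ Icc 0 T, ∀ s ∈ Icc 0 t, ‖w v₁ s - w v₂ s‖ ≤ Real.exp (l * t) * D := by
      intro t ht s hs
      have hs' : s ∈ Icc 0 T := ⟨hs.1, hs.2.trans ht.2⟩
      simp only [w]
      rw [← mul_sub, norm_mul, Complex.norm_real, Real.norm_of_nonneg (Real.exp_pos _).le,
        projIcc_of_mem hT.le hs', ← dist_eq_norm]
      have := hs.2
      gcongr
      exact ContinuousMap.dist_apply_le_dist _
    have hI : ∀ t ∈ Icc 0 T, ‖(∫ s in (0 : ℝ)..t, g s * w v₁ s) -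
        ∫ s in (0 : ℝ)..t, g s * w v₂ s‖ ≤ G * D * Real.exp (l * t) := by
      intro t ht
      rw [← intervalIntegral.integral_sub (hgw _).intervalIntegrable (hgw _).intervalIntegrable]
      have hb : ∀ s ∈ Ioc 0 t, ‖g s * w v₁ s - g s * w v₂ s‖ ≤ ‖g s‖ * (Real.exp (l * t) * D) := by
        intro s hs
        rw [← mul_sub, norm_mul]
        gcongr
        exact hwd t ht s ⟨hs.1.le, hs.2⟩
      refine (intervalIntegral.norm_integral_le_of_norm_le ht.1
        (.of_forall hb) (hg.norm.mul_const _).intervalIntegrable).trans ?_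
      rw [intervalIntegral.integral_mul_const, intervalIntegral.integral_of_le ht.1]
      have : ∫ s in Ioc 0 t, ‖g s‖ ≤ G :=
        setIntegral_le_integral hg.norm (.of_forall fun _ ↦ norm_nonneg _)
      have he := Real.exp_pos (l * t)
      calc _ ≤ G * (Real.exp (l * t) * D) := by gcongr
        _ = _ := by ring
    have hx := x.2
    have hO : ‖(∫ t in (0 : ℝ)..x, (b + ∫ s in (0 : ℝ)..t, g s * w v₁ s)) -
        ∫ t in (0 : ℝ)..x, (b + ∫ s in (0 : ℝ)..t, g s * w v₂ s)‖ ≤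
        G * D * (Real.exp (l * x) / l) := by
      rw [← intervalIntegral.integral_sub ((hin _).intervalIntegrable _ _)
        ((hin _).intervalIntegrable _ _)]
      have hc : Continuous fun t : ℝ ↦ G * D * Real.exp (l * t) := by fun_prop
      refine (intervalIntegral.norm_integral_le_of_norm_le hx.1 (.of_forall fun t ht ↦ ?_)
        (hc.intervalIntegrable _ _)).trans ?_
      · rw [add_sub_add_left_eq_sub]
        exact hI t ⟨ht.1.le, ht.2.trans hx.2⟩
      · rw [intervalIntegral.integral_const_mul, intervalIntegral.integral_comp_mul_left _ hl0.ne',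
          integral_exp, smul_eq_mul]
        have : Real.exp (l * 0) = 1 := by simp
        rw [this, div_eq_inv_mul]
        gcongr
        linarith
    simp only [F, ContinuousMap.coe_mk]
    rw [dist_eq_norm, ← mul_sub, add_sub_add_left_eq_sub, norm_mul, Complex.norm_real,
      Real.norm_of_nonneg (Real.exp_pos _).le]
    have hlt : G / l ≤ 1 / 2 := by rw [div_le_div_iff₀ hl0 two_pos]; linarith
    calc _ ≤ Real.exp (-(l * x)) * (G * D * (Real.exp (l * x) / l)) := by gcongr
      _ = (Real.exp (-(l * x)) * Real.exp (l * x)) * (G / l) * D := by ring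
      _ = G / l * D := by rw [← Real.exp_add]; simp
      _ ≤ _ := by push_cast; gcongr
  set v := hF.fixedPoint F
  have hv : F v = v := hF.fixedPoint_isFixedPt
  refine ⟨w v, hwc v, hgw v, fun x hx ↦ ?_⟩
  have h := congrArg (fun f : C(Icc 0 T, ℂ) ↦ f ⟨x, hx⟩) hv
  simp only [F, ContinuousMap.coe_mk] at h
  have hwx : w v x = (Real.exp (l * x) : ℂ) * v ⟨x, hx⟩ := by
    simp only [w]; rw [projIcc_of_mem hT.le hx]
  rw [hwx, ← h, ← mul_assoc, ← Complex.ofReal_mul, ← Real.exp_add]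
  simp

/-- The initial value problem for the Schrödinger equation is solvable. -/
lemma IsSchrodingerSolution.exists_of_data {T : ℝ} (hT : 0 < T) {V : ℝ → ℝ}
    (hV : MemLp V 2 (volume.restrict (Ico 0 T))) (E a b : ℂ) :
    ∃ ψ φ : ℝ → ℂ, IsSchrodingerSolution T V E ψ φ ∧ ψ 0 = a ∧ φ 0 = b := by
  have hVi : IntegrableOn (fun x ↦ (V x : ℂ) - E) (Ico 0 T) :=
    (hV.integrable (by norm_num)).ofReal.sub (integrable_const E)
  have hg := (integrable_indicator_iff measurableSet_Ico).2 hVi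
  obtain ⟨u, huc, hgu, hu⟩ := exists_integral_solution hT hg a b
  set g := (Ico 0 T).indicator fun x ↦ (V x : ℂ) - E with hgdef
  let φ : ℝ → ℂ := fun t ↦ b + ∫ s in (0 : ℝ)..t, g s * u s
  let ψ : ℝ → ℂ := fun x ↦ a + ∫ t in (0 : ℝ)..x, φ t
  have hφ : Continuous φ := continuous_const.add
      (intervalIntegral.continuous_primitive (fun _ _ ↦ hgu.intervalIntegrable) 0)
  refine ⟨ψ, φ, ⟨fun x _ ↦ ?_, absolutelyContinuous_primitive hgu b T, ?_⟩, by simp [ψ], by simp [φ]⟩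
  · exact ((hφ.integral_hasStrictDerivAt 0 x).hasDerivAt.const_add a).hasDerivWithinAt
  · filter_upwards [LocallyIntegrable.ae_hasDerivAt_integral hgu.locallyIntegrable] with x hx hxT
    refine ⟨_, (hx 0).const_add b, ?_⟩
    have h1 : ψ x = u x := (hu x ⟨hxT.1.le, hxT.2.le⟩).symm
    have h2 : g x = V x - E := indicator_of_mem (show x ∈ Ico 0 T from ⟨hxT.1.le, hxT.2⟩) _
    rw [h1, h2]
    ring

/-- The Wronskian of two solutions has the same value at both end points. -/
lemma IsSchrodingerSolution.wronskian {T : ℝ} (hT : 0 < T) {V : ℝ → ℝ} {E : ℂ}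
    {ψ₁ φ₁ ψ₂ φ₂ : ℝ → ℂ} (h₁ : IsSchrodingerSolution T V E ψ₁ φ₁)
    (h₂ : IsSchrodingerSolution T V E ψ₂ φ₂) :
    ψ₁ T * φ₂ T - φ₁ T * ψ₂ T = ψ₁ 0 * φ₂ 0 - φ₁ 0 * ψ₂ 0 := by
  have hI : uIcc 0 T = Icc 0 T := uIcc_of_le hT.le
  have key : ∀ ψ φ, IsSchrodingerSolution T V E ψ φ → AbsolutelyContinuousOnInterval ψ 0 T := by
    intro ψ φ h
    obtain ⟨C, hC⟩ := h.absCont.exists_bound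
    have hC0 : 0 ≤ C := (norm_nonneg _).trans (hC 0 (by simp))
    refine LipschitzOnWith.absolutelyContinuousOnInterval (K := ⟨C, hC0⟩) ?_
    rw [hI] at hC ⊢
    exact (convex_Icc 0 T).lipschitzOnWith_of_nnnorm_hasDerivWithin_le h.hasDeriv hC
  have hac := ((key _ _ h₁).fun_smul h₂.absCont).fun_sub (h₁.absCont.fun_smul (key _ _ h₂))
  obtain ⟨C, hC⟩ := hac.const_of_ae_hasDerivAt_zero (by
    have n0 : ∀ᵐ x : ℝ, x ≠ 0 := by simp [ae_iff, measure_singleton]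
    have nT : ∀ᵐ x : ℝ, x ≠ T := by simp [ae_iff, measure_singleton]
    filter_upwards [h₁.eqn, h₂.eqn, n0, nT] with x e₁ e₂ hx0 hxT hx
    rw [hI] at hx
    have hx' : x ∈ Ioo 0 T := ⟨lt_of_le_of_ne hx.1 hx0.symm, lt_of_le_of_ne hx.2 hxT⟩
    have hn : Icc 0 T ∈ nhds x := Icc_mem_nhds hx'.1 hx'.2
    obtain ⟨d₁, hd₁, q₁⟩ := e₁ hx'
    obtain ⟨d₂, hd₂, q₂⟩ := e₂ hx'
    have p₁ := (h₁.hasDeriv x hx).hasDerivAt hn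
    have p₂ := (h₂.hasDeriv x hx).hasDerivAt hn
    convert! (p₁.smul hd₂).sub (hd₁.smul p₂) using 1
    simp only [smul_eq_mul]
    linear_combination ψ₁ x * q₂ - ψ₂ x * q₁)
  have := (hC T (by simp)).trans (hC 0 (by simp)).symm
  simpa only [smul_eq_mul] using this

/-- The transfer matrix exists and is unique. -/
theorem existsUnique_isTransferMatrix {T : ℝ} (hT : 0 < T) {V : ℝ → ℝ}
    (hV : MemLp V 2 (volume.restrict (Ico 0 T))) (E : ℂ) :
    ∃! A : Matrix.SpecialLinearGroup (Fin 2) ℂ, IsTransferMatrix T V E A := by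
  obtain ⟨c, c', hc, hc0, hc0'⟩ := IsSchrodingerSolution.exists_of_data hT hV E 1 0
  obtain ⟨s, s', hs, hs0, hs0'⟩ := IsSchrodingerSolution.exists_of_data hT hV E 0 1
  have hW := hc.wronskian hT hs
  simp only [hc0, hc0', hs0, hs0'] at hW
  refine ⟨⟨!![c T, s T; c' T, s' T], by rw [Matrix.det_fin_two_of]; linear_combination hW⟩, ?_, ?_⟩
  · intro ψ φ h
    have w1 := h.wronskian hT hc
    have w2 := h.wronskian hT hs
    simp only [hc0, hc0', hs0, hs0'] at w1 w2
    ext i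
    fin_cases i
    · simp
      linear_combination (-ψ T) * hW - s T * w1 + c T * w2
    · simp
      linear_combination (-φ T) * hW - s' T * w1 + c' T * w2
  · intro A hA
    have a1 := hA c c' hc
    have a2 := hA s s' hs
    rw [hc0, hc0'] at a1
    rw [hs0, hs0'] at a2
    ext i j
    have b1 := congrFun a1 i
    have b2 := congrFun a2 i
    fin_cases i <;> fin_cases j <;> simp [Matrix.mulVec, dotProduct, Fin.sum_univ_two] at b1 b2 ⊢ <;>
      simp [b1, b2]

/-- The transfer matrix `A^E(V)` of `V ∈ L²[0, T)`: the unique matrix in `SL(2, ℂ)` with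
`(ψ(T), ψ'(T))ᵀ = A^E(V) (ψ(0), ψ'(0))ᵀ` whenever `-ψ'' + V ψ = E ψ`. -/
noncomputable def transferMatrix {T : ℝ} (hT : 0 < T) {V : ℝ → ℝ}
    (hV : MemLp V 2 (volume.restrict (Ico 0 T))) (E : ℂ) :
    Matrix.SpecialLinearGroup (Fin 2) ℂ :=
  (existsUnique_isTransferMatrix hT hV E).choose

/-! Put q = V₁ - V₂. For real k, let ψⱼ solve the equation with potential Vⱼ, energy k² and data
ψⱼ(0) = 1, ψⱼ'(0) = ik. Equal transfer matrices give ψ₁ and ψ₂ the same Cauchy data at T as well as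
at 0, so the boundary terms in Green's identity (`IsSchrodingerSolution.integral_sub_mul`) cancel
and ∫ q ψ₁ ψ₂ = 0. It remains to show that these products are complete.

Each solution is a Volterra perturbation of a plane wave, ψⱼ(x) = exp(ikx) (1 + ∫₀ˣ Kⱼ(x, w)
exp(-2ikw) dw), with a bounded kernel Kⱼ independent of k (`exists_solution_eq_kernelAmplitude`).
Such amplitudes are closed under multiplication, because products of Fourier integrals come from
convolutions (`kernelAmplitude_mul`). So, with η = 2k, ψ₁ψ₂ = exp(iηx) (1 + ∫ L(x, w) exp(-iηw) dw),
where L is bounded and supported in w > 0.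

After the substitution u = x - w, orthogonality to all products says that u ↦ q(u) + ∫ q(x) L(x, x -
u) dx has zero Fourier transform. It therefore vanishes almost everywhere. As L(x, x - u) = 0 for x
≤ u, this is a homogeneous backward Volterra equation for q on (0, T], and a Gronwall argument
(`ae_eq_zero_of_le_integral`) leaves only q = 0. -/

/-! ### Tools: Fubini on a triangle, convolution, Fourier uniqueness, Gronwall. -/

/-- Interchange of the order of integration over the triangle `0 ≤ t ≤ y ≤ x`. -/
lemma integral_mul_integral_triangle {𝕜 : Type*} [RCLike 𝕜] {f g : ℝ → 𝕜} (hf : Integrable f) (hg : Continuous g)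
    {x : ℝ} (hx : 0 ≤ x) :
    ∫ t in (0 : ℝ)..x, f t * ∫ y in t..x, g y =
      ∫ y in (0 : ℝ)..x, g y * ∫ t in (0 : ℝ)..y, f t := by
  have hfi : Integrable f (volume.restrict (Ioc 0 x)) := hf.restrict
  have hgi : Integrable g (volume.restrict (Ioc 0 x)) :=
    (hg.integrableOn_Icc (a := 0) (b := x)).mono_set Ioc_subset_Icc_self
  have hint : Integrable (Function.uncurry fun t y ↦ {p : ℝ × ℝ | p.1 < p.2}.indicator
      (fun p ↦ f p.1 * g p.2) (t, y))
      ((volume.restrict (Ioc 0 x)).prod (volume.restrict (Ioc 0 x))) :=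
    (hfi.mul_prod hgi).indicator (measurableSet_lt measurable_fst measurable_snd)
  have hswap := integral_integral_swap hint
  rw [intervalIntegral.integral_of_le hx, intervalIntegral.integral_of_le hx]
  convert hswap using 1
  · refine setIntegral_congr_fun measurableSet_Ioc fun t ht ↦ ?_
    have : ∀ y, {p : ℝ × ℝ | p.1 < p.2}.indicator (fun p ↦ f p.1 * g p.2) (t, y) =
        (Ioi t).indicator (fun y ↦ f t * g y) y := fun y ↦ by simp [indicator]
    simp only [this]
    rw [intervalIntegral.integral_of_le ht.2, setIntegral_indicator measurableSet_Ioi,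
      ← integral_const_mul]
    congr 2
    ext y
    simp only [mem_Ioc, mem_inter_iff, mem_Ioi]
    constructor
    · rintro ⟨h1, h2⟩; exact ⟨⟨ht.1.trans h1, h2⟩, h1⟩
    · rintro ⟨⟨h1, h2⟩, h3⟩; exact ⟨h3, h2⟩
  · refine setIntegral_congr_fun measurableSet_Ioc fun y hy ↦ ?_
    have : ∀ t, {p : ℝ × ℝ | p.1 < p.2}.indicator (fun p ↦ f p.1 * g p.2) (t, y) =
        (Iio y).indicator (fun t ↦ g y * f t) t := fun t ↦ by simp [indicator, mul_comm]
    simp only [this]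
    rw [intervalIntegral.integral_of_le hy.1.le, setIntegral_indicator measurableSet_Iio,
      ← integral_const_mul, integral_Ioc_eq_integral_Ioo]
    congr 2
    ext t
    simp only [mem_Ioo, mem_Ioc, mem_inter_iff, mem_Iio]
    exact ⟨fun ⟨h1, h2⟩ ↦ ⟨⟨h1, h2.le.trans hy.2⟩, h2⟩, fun ⟨⟨h1, _⟩, h3⟩ ↦ ⟨h1, h3⟩⟩

/-- The integral of the convolution of two functions supported on `[0, a]` and `[0, t]`. -/
lemma integral_mul_window_integral {e f : ℝ → ℂ} (he : Continuous e) (hf : Continuous f)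
    (hmul : ∀ r s, e (r + s) = e r * e s) {a t : ℝ} (ha : 0 ≤ a) (ht : 0 ≤ t) :
    ∫ w in (0 : ℝ)..(a + t), e w * ∫ s in (max 0 (w - a))..(min t w), f s =
      (∫ r in (0 : ℝ)..a, e r) * ∫ s in (0 : ℝ)..t, f s * e s := by
  have h1 : Integrable ((Ioc 0 a).indicator e) :=
    ((he.integrableOn_Icc (a := 0) (b := a)).mono_set Ioc_subset_Icc_self).integrable_indicator
      measurableSet_Ioc
  have h2 : Integrable ((Ioc 0 t).indicator fun s ↦ f s * e s) :=
    (((hf.mul he).integrableOn_Icc (a := 0) (b := t)).mono_set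
      Ioc_subset_Icc_self).integrable_indicator measurableSet_Ioc
  have h3 := integral_convolution (ContinuousLinearMap.mul ℂ ℂ) h2 h1
  rw [intervalIntegral.integral_of_le ha, intervalIntegral.integral_of_le ht,
    ← integral_indicator measurableSet_Ioc, ← integral_indicator measurableSet_Ioc, mul_comm]
  rw [ContinuousLinearMap.mul_apply'] at h3
  rw [← h3, intervalIntegral.integral_of_le (by positivity), ← integral_indicator measurableSet_Ioc]
  congr 1
  ext w
  rw [convolution_def]
  simp only [ContinuousLinearMap.mul_apply']
  -- Multiplicativity of `e` pulls `e w` out of the convolution; what remains of the second factor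
  -- only restricts `s` to a window ending at `w`.
  have h4 : ∀ s, (Ioc 0 t).indicator (fun s ↦ f s * e s) s * (Ioc 0 a).indicator e (w - s) =
      (Ioc 0 t ∩ Ico (w - a) w).indicator (fun s ↦ e w * f s) s := by
    intro s
    have hw : e w = e (w - s) * e s := by rw [← hmul]; simp
    by_cases hs : s ∈ Ioc 0 t
    · by_cases hs' : s ∈ Ico (w - a) w
      · have h5 : w - s ∈ Ioc 0 a := ⟨by linarith [hs'.2], by linarith [hs'.1]⟩
        rw [indicator_of_mem hs, indicator_of_mem h5, indicator_of_mem (mem_inter hs hs'), hw]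
        ring
      · have h5 : w - s ∉ Ioc 0 a := fun h ↦ hs' ⟨by linarith [h.2], by linarith [h.1]⟩
        rw [indicator_of_notMem h5, indicator_of_notMem (notMem_subset inter_subset_right hs'),
          mul_zero]
    · rw [indicator_of_notMem hs, indicator_of_notMem (notMem_subset inter_subset_left hs), zero_mul]
  simp only [h4]
  rw [integral_indicator (measurableSet_Ioc.inter measurableSet_Ico)]
  by_cases hw : w ∈ Ioc 0 (a + t)
  · have hle : max 0 (w - a) ≤ min t w :=
      max_le (le_min ht hw.1.le) (le_min (by linarith [hw.2]) (by linarith))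
    rw [indicator_of_mem hw, intervalIntegral.integral_of_le hle, ← integral_const_mul]
    refine setIntegral_congr_set ?_
    have hne : ∀ z : ℝ, ∀ᵐ s : ℝ, s ≠ z := fun z ↦ by simp [ae_iff, measure_singleton]
    filter_upwards [hne (w - a), hne w] with s hs1 hs2
    refine propext (?_ : s ∈ Ioc _ _ ↔ s ∈ Ioc _ _ ∩ Ico _ _)
    simp only [mem_Ioc, max_lt_iff, le_min_iff, mem_inter_iff, mem_Ico]
    constructor
    · rintro ⟨⟨p1, p2⟩, p3, p4⟩; exact ⟨⟨p1, p3⟩, p2.le, lt_of_le_of_ne p4 hs2⟩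
    · rintro ⟨⟨p1, p3⟩, p2, p4⟩; exact ⟨⟨p1, lt_of_le_of_ne p2 hs1.symm⟩, p3, p4.le⟩
  · rw [indicator_of_notMem hw]
    have : Ioc 0 t ∩ Ico (w - a) w = ∅ := by
      ext s
      simp only [mem_inter_iff, mem_Ioc, mem_Ico, mem_empty_iff_false, iff_false]
      rintro ⟨⟨p1, p2⟩, p3, p4⟩
      exact hw ⟨by linarith, by linarith⟩
    simp [this]

/-- A real integrable function with vanishing Fourier transform vanishes almost everywhere. -/
lemma ae_eq_zero_of_forall_integral_exp_eq_zero {h : ℝ → ℝ} (hh : Integrable h)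
    (h0 : ∀ k : ℝ, ∫ u, (h u : ℂ) * Complex.exp (k * u * Complex.I) = 0) : h =ᵐ[volume] 0 := by
  set p : ℝ → ENNReal := fun u ↦ ENNReal.ofReal (h u)
  set n : ℝ → ENNReal := fun u ↦ ENNReal.ofReal (-h u)
  have hp : AEMeasurable p := hh.aemeasurable.ennreal_ofReal
  have hn : AEMeasurable n := hh.aemeasurable.neg.ennreal_ofReal
  have hp1 : ∫⁻ u, p u ≠ ⊤ := hh.lintegral_lt_top.ne
  have hn1 : ∫⁻ u, n u ≠ ⊤ := hh.neg.lintegral_lt_top.ne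
  have := isFiniteMeasure_withDensity hp1
  have := isFiniteMeasure_withDensity hn1
  -- The positive and negative parts of `h` are densities of finite measures; the hypothesis says
  -- that their characteristic functions agree.
  have heq : volume.withDensity p = volume.withDensity n := by
    refine Measure.ext_of_charFun (funext fun k ↦ ?_)
    rw [charFun_apply_real, charFun_apply_real,
      integral_withDensity_eq_integral_toReal_smul₀ hp (by simp [p]),
      integral_withDensity_eq_integral_toReal_smul₀ hn (by simp [n]), ← sub_eq_zero]
    have hb : ∀ g : ℝ → ℝ, Integrable g →
        Integrable fun u ↦ (g u) • Complex.exp (k * u * Complex.I) := fun g hg ↦ by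
      simp only [Complex.real_smul]
      refine (hg.ofReal (𝕜 := ℂ)).mul_bdd (c := 1) (Continuous.aestronglyMeasurable (by fun_prop))
        (.of_forall fun u ↦ ?_)
      rw [← Complex.ofReal_mul, Complex.norm_exp_ofReal_mul_I]
    rw [← integral_sub (hb _ ?_) (hb _ ?_), ← h0 k]
    rotate_left
    · simpa only [p, ENNReal.toReal_ofReal'] using hh.pos_part
    · simpa only [n, ENNReal.toReal_ofReal'] using hh.neg_part
    congr 1
    ext u
    rw [← sub_smul]
    simp only [p, n, ENNReal.toReal_ofReal', Complex.real_smul]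
    congr 2
    exact max_zero_sub_max_neg_zero_eq_self (h u)
  have hae := (withDensity_eq_iff hp hn hp1).1 heq
  filter_upwards [hae] with u hu
  have := congrArg ENNReal.toReal hu
  simp only [p, n, ENNReal.toReal_ofReal'] at this
  rw [← max_zero_sub_max_neg_zero_eq_self (h u), this]
  simp

/-- A Gronwall-type uniqueness statement for a backward Volterra inequality. -/
lemma ae_eq_zero_of_le_integral {q : ℝ → ℝ} (hq : Integrable q) {R C : ℝ} (hR : 0 ≤ R)
    (hC : 0 < C) (hle : ∀ᵐ u, u ∈ Ioc 0 R → |q u| ≤ C * ∫ x in u..R, |q x|) :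
    ∀ᵐ u, u ∈ Ioc 0 R → q u = 0 := by
  -- Since `q` is only integrable, the inequality is tested in a weighted L¹ norm. The rate 2C gives
  -- ∫₀ᵗ g ≤ g(t) / (2C), hence A ≤ A / 2 for the weighted norm A.
  set g : ℝ → ℝ := fun u ↦ Real.exp (2 * C * u) with hg
  have hgc : Continuous g := by fun_prop
  have hqa : Integrable fun u ↦ |q u| := hq.abs
  have hi : ∀ G : ℝ → ℝ, Continuous G → IntervalIntegrable (fun u ↦ |q u| * G u) volume 0 R :=
    fun G hG ↦ hqa.intervalIntegrable.mul_continuousOn hG.continuousOn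
  have hprim : ∀ {f : ℝ → ℝ}, Integrable f → ∀ c, Continuous fun u ↦ ∫ x in c..u, f x :=
    fun hf c ↦ intervalIntegral.continuous_primitive (fun _ _ ↦ hf.intervalIntegrable) c
  have hgp : Continuous fun u ↦ ∫ x in (0 : ℝ)..u, g x :=
    intervalIntegral.continuous_primitive (fun _ _ ↦ hgc.intervalIntegrable _ _) 0
  have htail : Continuous fun u ↦ ∫ x in u..R, |q x| := by
    refine (hprim hqa R).neg.congr fun u ↦ ?_
    exact (intervalIntegral.integral_symm R u).symm
  have hswap : ∫ u in (0 : ℝ)..R, g u * ∫ x in u..R, |q x| =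
      ∫ t in (0 : ℝ)..R, |q t| * ∫ u in (0 : ℝ)..t, g u := by
    -- This is the identity for the complementary triangle; subtracting both of its sides from (∫
    -- g)(∫ |q|) over [0, R] gives the one needed.
    have h1 := integral_mul_integral_triangle hqa hgc hR
    have h2 : ∀ u, ∫ x in u..R, |q x| =
        (∫ x in (0 : ℝ)..R, |q x|) - ∫ x in (0 : ℝ)..u, |q x| := fun u ↦
      (intervalIntegral.integral_interval_sub_left hqa.intervalIntegrable
        hqa.intervalIntegrable).symm
    have h3 : ∀ t, ∫ u in (0 : ℝ)..t, g u =
        (∫ u in (0 : ℝ)..R, g u) - ∫ u in t..R, g u := fun t ↦ by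
      rw [← intervalIntegral.integral_add_adjacent_intervals (hgc.intervalIntegrable 0 t)
        (hgc.intervalIntegrable t R)]
      ring
    have h4 : Continuous fun t ↦ ∫ u in t..R, g u := by
      refine ((continuous_const (y := ∫ u in (0 : ℝ)..R, g u)).sub hgp).congr fun t ↦ ?_
      rw [Pi.sub_apply, h3 t]; ring
    have h5 : ∫ t in (0 : ℝ)..R, |q t| * ∫ u in (0 : ℝ)..t, g u = ∫ t in (0 : ℝ)..R,
        (|q t| * (∫ u in (0 : ℝ)..R, g u) - |q t| * ∫ u in t..R, g u) := by
      congr 1; ext t; rw [h3 t, mul_sub]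
    have h6 : ∫ u in (0 : ℝ)..R, g u * ∫ x in u..R, |q x| = ∫ u in (0 : ℝ)..R,
        (g u * (∫ x in (0 : ℝ)..R, |q x|) - g u * ∫ x in (0 : ℝ)..u, |q x|) := by
      congr 1; ext u; rw [h2 u, mul_sub]
    rw [h5, h6, intervalIntegral.integral_sub, intervalIntegral.integral_sub, h1,
      intervalIntegral.integral_mul_const, intervalIntegral.integral_mul_const]
    · ring
    · exact hi _ continuous_const
    · exact hi _ h4
    · exact (hgc.mul continuous_const).intervalIntegrable _ _
    · exact (hgc.mul (hprim hqa 0)).intervalIntegrable _ _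
  set A := ∫ u in (0 : ℝ)..R, |q u| * g u with hA
  have hA1 : A ≤ C * ∫ u in (0 : ℝ)..R, g u * ∫ x in u..R, |q x| := by
    rw [← intervalIntegral.integral_const_mul]
    refine intervalIntegral.integral_mono_ae_restrict hR (hi g hgc)
      ((continuous_const.mul (hgc.mul htail)).intervalIntegrable _ _) ?_
    have hne : ∀ᵐ s : ℝ, s ≠ 0 := by simp [ae_iff, measure_singleton]
    rw [Filter.EventuallyLE, ae_restrict_iff' measurableSet_Icc]
    filter_upwards [hle, hne] with u hu hu0 huR
    have h1 := hu ⟨lt_of_le_of_ne huR.1 hu0.symm, huR.2⟩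
    have h2 : 0 ≤ g u := (Real.exp_pos _).le
    calc |q u| * g u ≤ (C * ∫ x in u..R, |q x|) * g u := by gcongr
      _ = _ := by ring
  have hA2 : ∫ t in (0 : ℝ)..R, |q t| * ∫ u in (0 : ℝ)..t, g u ≤
      ∫ t in (0 : ℝ)..R, |q t| * g t * (2 * C)⁻¹ := by
    refine intervalIntegral.integral_mono_on hR (hi _ hgp) ((hi g hgc).mul_const _) fun t _ ↦ ?_
    rw [mul_assoc]
    gcongr
    simp only [hg]
    rw [intervalIntegral.integral_comp_mul_left _ (by positivity), integral_exp, smul_eq_mul,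
      mul_comm]
    gcongr
    have := Real.exp_pos (2 * C * 0)
    linarith
  rw [intervalIntegral.integral_mul_const] at hA2
  have hA3 : A ≤ 0 := by
    have : A ≤ C * (A * (2 * C)⁻¹) := hA1.trans (by rw [hswap]; gcongr)
    have e : C * (A * (2 * C)⁻¹) = A / 2 := by field_simp
    linarith
  have hpos : ∀ u, 0 ≤ |q u| * g u := fun u ↦ mul_nonneg (abs_nonneg _) (Real.exp_pos _).le
  have hA0 : A = 0 := le_antisymm hA3 (intervalIntegral.integral_nonneg hR fun u _ ↦ hpos u)
  rw [hA, intervalIntegral.integral_eq_zero_iff_of_nonneg_ae (.of_forall hpos) (hi g hgc)] at hA0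
  have h5 := (ae_restrict_iff' (measurableSet_Ioc.union measurableSet_Ioc)).1 hA0
  filter_upwards [h5] with u hu huR
  have h6 := hu (Or.inl huR)
  simpa [hg, Real.exp_ne_zero] using h6

/-! ### Window integrals and the transformation kernel. -/

/-- The integral of `K t` over the window of length `(x - t)⁺` ending at `w`, cut off at
`[0, t]`. -/
noncomputable def windowIntegral (K : ℝ → ℝ → ℝ) (x w t : ℝ) : ℝ :=
  ∫ s in (min t (max 0 (w - max (x - t) 0)))..(min t (max 0 w)), K t s

lemma continuous_windowIntegral {K : ℝ → ℝ → ℝ} (hK : Continuous (Function.uncurry K)) :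
    Continuous fun p : ℝ × ℝ × ℝ ↦ windowIntegral K p.1 p.2.1 p.2.2 := by
  have hc : Continuous (Function.uncurry fun (p : ℝ × ℝ × ℝ) (s : ℝ) ↦ K p.2.2 s) :=
    hK.comp (by fun_prop : Continuous fun q : (ℝ × ℝ × ℝ) × ℝ ↦ (q.1.2.2, q.2))
  have h : ∀ s : ℝ × ℝ × ℝ → ℝ, Continuous s →
      Continuous fun p : ℝ × ℝ × ℝ ↦ ∫ s in (0 : ℝ)..s p, K p.2.2 s := fun s hs ↦
    intervalIntegral.continuous_parametric_intervalIntegral_of_continuous hc hs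
  have h1 := (h (fun p ↦ min p.2.2 (max 0 p.2.1)) (by fun_prop)).sub
    (h (fun p ↦ min p.2.2 (max 0 (p.2.1 - max (p.1 - p.2.2) 0))) (by fun_prop))
  refine h1.congr fun p ↦ ?_
  have hKt : Continuous (K p.2.2) := hK.comp (by fun_prop : Continuous fun s : ℝ ↦ (p.2.2, s))
  exact intervalIntegral.integral_interval_sub_left (hKt.intervalIntegrable _ _)
    (hKt.intervalIntegrable _ _)

/-- Clamping by `min` and `max` is 1-Lipschitz, so it cannot lengthen the window beyond (x - t)⁺. -/
lemma abs_windowIntegral_le {K : ℝ → ℝ → ℝ} {x w t M : ℝ} (ht : 0 ≤ t)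
    (hM : ∀ s ∈ Icc 0 t, |K t s| ≤ M) : |windowIntegral K x w t| ≤ M * max (x - t) 0 := by
  have hM0 : 0 ≤ M := (abs_nonneg _).trans (hM 0 ⟨le_rfl, ht⟩)
  have hlo : 0 ≤ min t (max 0 (w - max (x - t) 0)) := le_min ht (le_max_left _ _)
  have hhi : 0 ≤ min t (max 0 w) := le_min ht (le_max_left _ _)
  refine (intervalIntegral.norm_integral_le_of_norm_le_const (f := K t) (C := M)
    fun s hs ↦ ?_).trans (mul_le_mul_of_nonneg_left ?_ hM0)
  · have := uIoc_subset_uIcc hs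
    exact hM s ⟨(le_min hlo hhi).trans this.1,
      this.2.trans (max_le (min_le_left _ _) (min_le_left _ _))⟩
  · refine (abs_min_sub_min_le_max _ _ _ _).trans (max_le (by simp) ?_)
    refine (abs_max_sub_max_le_max _ _ _ _).trans (max_le (by simp) ?_)
    rw [sub_sub_cancel, abs_of_nonneg (le_max_right _ _)]

lemma windowIntegral_sub {K₁ K₂ : ℝ → ℝ → ℝ} (h₁ : Continuous (Function.uncurry K₁))
    (h₂ : Continuous (Function.uncurry K₂)) (x w t : ℝ) :
    windowIntegral K₁ x w t - windowIntegral K₂ x w t =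
      windowIntegral (fun t s ↦ K₁ t s - K₂ t s) x w t :=
  (intervalIntegral.integral_sub
    ((h₁.comp (by fun_prop : Continuous fun s : ℝ ↦ (t, s))).intervalIntegrable _ _)
    ((h₂.comp (by fun_prop : Continuous fun s : ℝ ↦ (t, s))).intervalIntegrable _ _)).symm

/-- On the genuine domain the clamps reduce to the limits of `integral_mul_window_integral` with a =
x - t. -/
lemma windowIntegral_eq {K : ℝ → ℝ → ℝ} {x w t : ℝ} (hw : 0 ≤ w) (hwx : w ≤ x) (ht : 0 ≤ t)
    (htx : t ≤ x) : windowIntegral K x w t = ∫ s in (max 0 (w - (x - t)))..(min t w), K t s := by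
  rw [windowIntegral, max_eq_left (sub_nonneg.2 htx), max_eq_right hw,
    min_eq_right (max_le ht (by linarith))]

/-- This lets the kernel equation integrate over the fixed interval [0, T] in place of [0, x]. -/
lemma windowIntegral_eq_zero {K : ℝ → ℝ → ℝ} {x w t : ℝ} (htx : x ≤ t) :
    windowIntegral K x w t = 0 := by
  rw [windowIntegral, max_eq_right (sub_nonpos.2 htx), sub_zero, intervalIntegral.integral_same]

lemma intervalIntegrable_mul_windowIntegral {V : ℝ → ℝ} (hV : Integrable V) {K : ℝ → ℝ → ℝ}
    (hK : Continuous (Function.uncurry K)) (x w a b : ℝ) :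
    IntervalIntegrable (fun t ↦ V t * windowIntegral K x w t) volume a b :=
  hV.intervalIntegrable.mul_continuousOn
    ((continuous_windowIntegral hK).comp
      (by fun_prop : Continuous fun t : ℝ ↦ (x, w, t))).continuousOn

/-- Dominated convergence: the window integral is continuous, hence bounded on the compact cube, and
|V| is integrable. -/
lemma continuousOn_integral_mul_windowIntegral {V : ℝ → ℝ} (hV : Integrable V) {K : ℝ → ℝ → ℝ}
    (hK : Continuous (Function.uncurry K)) {T : ℝ} (hT : 0 ≤ T) :
    ContinuousOn (fun p : ℝ × ℝ ↦ ∫ t in (0 : ℝ)..T, V t * windowIntegral K p.1 p.2 t)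
      (Icc 0 T ×ˢ Icc 0 T) := by
  obtain ⟨M, hM⟩ := (isCompact_Icc.prod (isCompact_Icc.prod isCompact_Icc)).exists_bound_of_continuousOn
    (s := Icc (0 : ℝ) T ×ˢ (Icc (0 : ℝ) T ×ˢ Icc (0 : ℝ) T))
    (continuous_windowIntegral hK).continuousOn
  intro p₀ hp₀
  refine intervalIntegral.continuousWithinAt_of_dominated_interval (bound := fun t ↦ |V t| * M)
    (.of_forall fun p ↦ ?_) ?_ (hV.abs.mul_const M).intervalIntegrable
    (.of_forall fun t _ ↦ ?_)
  · exact (intervalIntegrable_mul_windowIntegral hV hK p.1 p.2 0 T).def'.aestronglyMeasurable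
  · filter_upwards [self_mem_nhdsWithin] with p hp
    refine .of_forall fun t ht ↦ ?_
    rw [uIoc_of_le hT] at ht
    rw [norm_mul, Real.norm_eq_abs]
    exact mul_le_mul_of_nonneg_left (hM (p.1, p.2, t) ⟨hp.1, hp.2, ht.1.le, ht.2⟩) (abs_nonneg _)
  · exact (continuous_const.mul ((continuous_windowIntegral hK).comp
      (by fun_prop : Continuous fun p : ℝ × ℝ ↦ (p.1, p.2, t)))).continuousWithinAt

/-- Existence of the transformation kernel, by contraction in a weighted norm. -/
lemma exists_transformationKernel {T : ℝ} (hT : 0 < T) {V : ℝ → ℝ} (hV : Integrable V) :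
    ∃ K : ℝ → ℝ → ℝ, Continuous (Function.uncurry K) ∧ (∃ C, ∀ x w, |K x w| ≤ C) ∧
      ∀ x ∈ Icc 0 T, ∀ w ∈ Icc 0 T, K x w = (∫ t in (0 : ℝ)..(x - w), V t) +
        ∫ t in (0 : ℝ)..T, V t * windowIntegral K x w t := by
  set G : ℝ := ∫ s, |V s| with hG
  have hG0 : 0 ≤ G := integral_nonneg fun _ ↦ abs_nonneg _
  set l : ℝ := 2 * G + 1 with hl
  have hl0 : 0 < l := by positivity
  -- The fixed point is sought as v = exp(-lx) K; `ext` removes the weight and extends beyond the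
  -- square by projection.
  let ext : C(Icc 0 T × Icc 0 T, ℝ) → ℝ → ℝ → ℝ := fun v t s ↦
    Real.exp (l * (projIcc 0 T hT.le t : ℝ)) * v (projIcc 0 T hT.le t, projIcc 0 T hT.le s)
  have hext : ∀ v, Continuous (Function.uncurry (ext v)) := fun v ↦ by
    have hp := continuous_projIcc (a := 0) (b := T) (h := hT.le)
    simp only [ext, Function.uncurry_def]
    fun_prop
  let F : C(Icc 0 T × Icc 0 T, ℝ) → C(Icc 0 T × Icc 0 T, ℝ) := fun v ↦
    ⟨fun p ↦ Real.exp (-(l * (p.1 : ℝ))) * ((∫ t in (0 : ℝ)..((p.1 : ℝ) - p.2), V t) +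
      ∫ t in (0 : ℝ)..T, V t * windowIntegral (ext v) p.1 p.2 t), by
      have h1 : Continuous fun p : Icc 0 T × Icc 0 T ↦ ∫ t in (0 : ℝ)..((p.1 : ℝ) - p.2), V t :=
        (intervalIntegral.continuous_primitive (fun _ _ ↦ hV.intervalIntegrable) 0).comp
          (by fun_prop)
      have h2 : Continuous fun p : Icc 0 T × Icc 0 T ↦
          ∫ t in (0 : ℝ)..T, V t * windowIntegral (ext v) p.1 p.2 t :=
        (continuousOn_integral_mul_windowIntegral hV (hext v) hT.le).comp_continuous
          (f := fun p : Icc 0 T × Icc 0 T ↦ ((p.1 : ℝ), (p.2 : ℝ))) (by fun_prop) fun p ↦ ⟨p.1.2, p.2.2⟩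
      exact Continuous.mul (by fun_prop) (h1.add h2)⟩
  have hF : ContractingWith (1 / 2) F := by
    refine ⟨by rw [← NNReal.coe_lt_coe]; norm_num, LipschitzWith.of_dist_le_mul fun v₁ v₂ ↦ ?_⟩
    rw [ContinuousMap.dist_le (by positivity)]
    rintro ⟨⟨x, hx⟩, ⟨w, hw⟩⟩
    set D := dist v₁ v₂ with hD
    have hD0 : 0 ≤ D := dist_nonneg
    simp only [F, ContinuousMap.coe_mk]
    rw [Real.dist_eq, ← mul_sub, add_sub_add_left_eq_sub, ← intervalIntegral.integral_sub
      (intervalIntegrable_mul_windowIntegral hV (hext v₁) x w 0 T)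
      (intervalIntegrable_mul_windowIntegral hV (hext v₂) x w 0 T), abs_mul, Real.abs_exp]
    have hb : ∀ t ∈ Ioc 0 T, ‖V t * windowIntegral (ext v₁) x w t -
        V t * windowIntegral (ext v₂) x w t‖ ≤ |V t| * (D * Real.exp (l * x) / l) := by
      intro t ht
      rw [← mul_sub, norm_mul, Real.norm_eq_abs, windowIntegral_sub (hext v₁) (hext v₂),
        Real.norm_eq_abs]
      refine mul_le_mul_of_nonneg_left ?_ (abs_nonneg _)
      have h1 : |windowIntegral (fun t s ↦ ext v₁ t s - ext v₂ t s) x w t| ≤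
          Real.exp (l * t) * D * max (x - t) 0 := by
        refine abs_windowIntegral_le ht.1.le fun s _ ↦ ?_
        simp only [ext]
        rw [← mul_sub, abs_mul, Real.abs_exp, projIcc_of_mem hT.le ⟨ht.1.le, ht.2⟩, ← Real.dist_eq]
        gcongr
        exact ContinuousMap.dist_apply_le_dist _
      refine h1.trans ?_
      rcases le_total x t with h | h
      · rw [max_eq_right (sub_nonpos.2 h), mul_zero]
        positivity
      · rw [max_eq_left (sub_nonneg.2 h), le_div_iff₀ hl0]
        -- The bound l y ≤ exp(l y) turns the window length x - t into the factor 1 / l, so the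
        -- Lipschitz constant is G / l ≤ 1 / 2.
        have h2 : l * (x - t) ≤ Real.exp (l * (x - t)) := by
          linarith [Real.add_one_le_exp (l * (x - t))]
        calc Real.exp (l * t) * D * (x - t) * l = D * (Real.exp (l * t) * (l * (x - t))) := by ring
          _ ≤ D * (Real.exp (l * t) * Real.exp (l * (x - t))) := by gcongr
          _ = D * Real.exp (l * x) := by rw [← Real.exp_add]; ring_nf
    have hI := intervalIntegral.norm_integral_le_of_norm_le hT.le (.of_forall hb)
      (hV.abs.mul_const _).intervalIntegrable
    rw [intervalIntegral.integral_mul_const, intervalIntegral.integral_of_le hT.le,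
      Real.norm_eq_abs] at hI
    have hVG : ∫ s in Ioc 0 T, |V s| ≤ G :=
      setIntegral_le_integral hV.abs (.of_forall fun _ ↦ abs_nonneg _)
    have hlt : G / l ≤ 1 / 2 := by rw [div_le_div_iff₀ hl0 two_pos]; linarith
    calc _ ≤ Real.exp (-(l * x)) * (G * (D * Real.exp (l * x) / l)) := by
          refine mul_le_mul_of_nonneg_left ?_ (Real.exp_pos _).le
          rw [intervalIntegral.integral_of_le hT.le] at hI ⊢
          exact hI.trans (mul_le_mul_of_nonneg_right hVG (by positivity))
      _ = (Real.exp (-(l * x)) * Real.exp (l * x)) * (G / l) * D := by ring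
      _ = G / l * D := by rw [← Real.exp_add]; simp
      _ ≤ _ := by push_cast; gcongr
  set v := hF.fixedPoint F
  have hv : F v = v := hF.fixedPoint_isFixedPt
  refine ⟨ext v, hext v, ⟨Real.exp (l * T) * ‖v‖, fun x w ↦ ?_⟩, fun x hx w hw ↦ ?_⟩
  · simp only [ext]
    rw [abs_mul, Real.abs_exp]
    have := (projIcc 0 T hT.le x).2.2
    gcongr
    exact v.norm_coe_le_norm _
  · have h := congrArg (fun f : C(Icc 0 T × Icc 0 T, ℝ) ↦ f (⟨x, hx⟩, ⟨w, hw⟩)) hv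
    simp only [F, ContinuousMap.coe_mk] at h
    have hvx : ext v x w = Real.exp (l * x) * v (⟨x, hx⟩, ⟨w, hw⟩) := by
      simp only [ext]; rw [projIcc_of_mem hT.le hx, projIcc_of_mem hT.le hw]
    rw [hvx, ← h, ← mul_assoc, ← Real.exp_add]
    simp

/-! ### Characters and the kernel form of solutions. -/

/-- The unitary character `x ↦ exp (i ξ x)` of the real line. -/
noncomputable def unitaryChar (ξ x : ℝ) : ℂ := Complex.exp ((ξ * x : ℝ) * Complex.I)

lemma unitaryChar_add (ξ x y : ℝ) :
    unitaryChar ξ (x + y) = unitaryChar ξ x * unitaryChar ξ y := by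
  simp only [unitaryChar, ← Complex.exp_add]
  push_cast
  ring_nf

@[simp]
lemma unitaryChar_zero (ξ : ℝ) : unitaryChar ξ 0 = 1 := by simp [unitaryChar]

@[simp]
lemma norm_unitaryChar (ξ x : ℝ) : ‖unitaryChar ξ x‖ = 1 := Complex.norm_exp_ofReal_mul_I _

@[fun_prop]
lemma continuous_unitaryChar (ξ : ℝ) : Continuous (unitaryChar ξ) := by
  unfold unitaryChar
  fun_prop

lemma unitaryChar_mul_neg (ξ x : ℝ) : unitaryChar ξ x * unitaryChar ξ (-x) = 1 := by
  rw [← unitaryChar_add, add_neg_cancel, unitaryChar_zero]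

lemma hasDerivAt_unitaryChar (ξ x : ℝ) :
    HasDerivAt (unitaryChar ξ) (ξ * Complex.I * unitaryChar ξ x) x := by
  have h1 : HasDerivAt (fun x : ℝ ↦ ((ξ * x : ℝ) : ℂ) * Complex.I) (ξ * Complex.I) x := by
    have := ((hasDerivAt_id x).const_mul ξ).ofReal_comp.mul_const Complex.I
    simpa using this
  convert! h1.cexp using 1
  rw [mul_comm]
  rfl

lemma contDiff_one_of_hasDerivAt {f f' : ℝ → ℂ} (hf' : Continuous f')
    (h : ∀ x, HasDerivAt f (f' x) x) : ContDiff ℝ 1 f := by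
  refine contDiff_one_iff_deriv.2 ⟨fun x ↦ (h x).differentiableAt, ?_⟩
  rwa [funext fun x ↦ (h x).deriv]

lemma contDiff_unitaryChar (ξ : ℝ) : ContDiff ℝ 1 (unitaryChar ξ) :=
  contDiff_one_of_hasDerivAt (by fun_prop) (hasDerivAt_unitaryChar ξ)

/-- The amplitude `1 + ∫₀ˣ K(x, w) exp (i ξ w) dw` generated by a transformation kernel. -/
noncomputable def kernelAmplitude (K : ℝ → ℝ → ℝ) (ξ x : ℝ) : ℂ :=
  1 + ∫ w in (0 : ℝ)..x, (K x w : ℂ) * unitaryChar ξ w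

lemma continuous_kernelAmplitude {K : ℝ → ℝ → ℝ} (hK : Continuous (Function.uncurry K)) (ξ : ℝ) :
    Continuous (kernelAmplitude K ξ) := by
  refine continuous_const.add
    (intervalIntegral.continuous_parametric_intervalIntegral_of_continuous ?_ continuous_id)
  have h1 : Continuous fun p : ℝ × ℝ ↦ K p.1 p.2 := hK
  simp only [Function.uncurry_def]
  fun_prop

/-- The amplitude generated by the transformation kernel solves a Volterra equation. -/
lemma kernelAmplitude_eq {T : ℝ} {V : ℝ → ℝ} (hV : Integrable V) {K : ℝ → ℝ → ℝ}
    (hK : Continuous (Function.uncurry K)) {C : ℝ} (hC : ∀ x w, |K x w| ≤ C)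
    (heq : ∀ x ∈ Icc 0 T, ∀ w ∈ Icc 0 T, K x w = (∫ t in (0 : ℝ)..(x - w), V t) +
      ∫ t in (0 : ℝ)..T, V t * windowIntegral K x w t) (ξ : ℝ) {x : ℝ} (hx : x ∈ Icc 0 T) :
    kernelAmplitude K ξ x = 1 + ∫ t in (0 : ℝ)..x,
      (V t : ℂ) * kernelAmplitude K ξ t * ∫ r in (0 : ℝ)..(x - t), unitaryChar ξ r := by
  set e := unitaryChar ξ
  have he : Continuous e := continuous_unitaryChar ξ
  have hVc : Integrable fun t ↦ (V t : ℂ) := hV.ofReal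
  have hT : 0 ≤ T := hx.1.trans hx.2
  have hK1 : ∫ w in (0 : ℝ)..x, e w * ∫ t in (0 : ℝ)..(x - w), (V t : ℂ) =
      ∫ t in (0 : ℝ)..x, (V t : ℂ) * ∫ r in (0 : ℝ)..(x - t), e r := by
    have h1 := intervalIntegral.integral_comp_sub_left (a := 0) (b := x)
      (fun y ↦ e (x - y) * ∫ t in (0 : ℝ)..y, (V t : ℂ)) x
    simp only [sub_sub_cancel, sub_self, sub_zero] at h1
    have hex : Continuous fun y ↦ e (x - y) := he.comp (by fun_prop)
    rw [h1, ← integral_mul_integral_triangle hVc hex hx.1]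
    congr 1
    ext t
    have h2 := intervalIntegral.integral_comp_sub_left (a := t) (b := x) e x
    rw [sub_self] at h2
    rw [← h2]
  -- After Fubini the range t > x contributes nothing, and for t ≤ x the w-integral is that of a
  -- convolution, so it factors.
  have hK2 : ∫ w in (0 : ℝ)..x, e w * ∫ t in (0 : ℝ)..T, (V t : ℂ) * windowIntegral K x w t =
      ∫ t in (0 : ℝ)..x, (V t : ℂ) *
        ((∫ r in (0 : ℝ)..(x - t), e r) * ∫ s in (0 : ℝ)..t, (K t s : ℂ) * e s) := by
    have hWc : Continuous fun p : ℝ × ℝ ↦ windowIntegral K x p.1 p.2 :=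
      (continuous_windowIntegral hK).comp (by fun_prop : Continuous fun p : ℝ × ℝ ↦ (x, p.1, p.2))
    have hint : Integrable (Function.uncurry fun w t ↦
        e w * ((V t : ℂ) * windowIntegral K x w t))
        ((volume.restrict (Ioc 0 x)).prod (volume.restrict (Ioc 0 T))) := by
      have h1 : Integrable e (volume.restrict (Ioc 0 x)) :=
        (he.integrableOn_Icc (a := 0) (b := x)).mono_set Ioc_subset_Icc_self
      have h2 := (h1.mul_prod (hVc.restrict (s := Ioc 0 T))).mul_bdd (c := C * x)
        (g := fun p : ℝ × ℝ ↦ (windowIntegral K x p.1 p.2 : ℂ))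
        (Complex.continuous_ofReal.comp hWc).aestronglyMeasurable ?_
      · refine h2.congr (.of_forall fun p ↦ ?_)
        simp only [Function.uncurry]
        ring
      · rw [Measure.prod_restrict, ae_restrict_iff' (measurableSet_Ioc.prod measurableSet_Ioc)]
        refine .of_forall fun p hp ↦ ?_
        rw [Complex.norm_real, Real.norm_eq_abs]
        refine (abs_windowIntegral_le hp.2.1.le fun s _ ↦ hC _ s).trans ?_
        have hC0 : 0 ≤ C := (abs_nonneg _).trans (hC 0 0)
        gcongr
        exact max_le (by linarith [hp.2.1]) hx.1
    have hswap := integral_integral_swap hint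
    rw [← intervalIntegral.integral_of_le hT] at hswap
    have hl : ∫ w in (0 : ℝ)..x, e w * ∫ t in (0 : ℝ)..T, (V t : ℂ) * windowIntegral K x w t =
        ∫ w in Ioc 0 x, ∫ t in Ioc 0 T, e w * ((V t : ℂ) * windowIntegral K x w t) := by
      rw [intervalIntegral.integral_of_le hx.1]
      simp only [intervalIntegral.integral_of_le hT, integral_const_mul]
    rw [hl, hswap]
    have hzero : ∫ t in x..T, ∫ w in Ioc 0 x, e w * ((V t : ℂ) * windowIntegral K x w t) = 0 := by
      refine intervalIntegral.integral_zero_ae (.of_forall fun t ht ↦ ?_)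
      rw [uIoc_of_le hx.2] at ht
      simp [windowIntegral_eq_zero ht.1.le]
    have hii : ∀ a b : ℝ, Ioc a b ⊆ Ioc 0 T → a ≤ b → IntervalIntegrable
        (fun t ↦ ∫ w in Ioc 0 x, e w * ((V t : ℂ) * windowIntegral K x w t)) volume a b :=
      fun a b hab hle ↦ (intervalIntegrable_iff_integrableOn_Ioc_of_le hle).2
        (IntegrableOn.mono_set hint.integral_prod_right hab)
    rw [← intervalIntegral.integral_add_adjacent_intervals
      (hii 0 x (Ioc_subset_Ioc_right hx.2) hx.1) (hii x T (Ioc_subset_Ioc_left hx.1) hx.2),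
      hzero, add_zero]
    refine intervalIntegral.integral_congr fun t ht ↦ ?_
    rw [uIcc_of_le hx.1] at ht
    have hKt : Continuous fun s ↦ (K t s : ℂ) := Complex.continuous_ofReal.comp
      (hK.comp (by fun_prop : Continuous fun s : ℝ ↦ (t, s)))
    have h3 := integral_mul_window_integral he hKt (unitaryChar_add ξ) (sub_nonneg.2 ht.2) ht.1
    rw [sub_add_cancel] at h3
    rw [← h3, ← intervalIntegral.integral_of_le hx.1, ← intervalIntegral.integral_const_mul]
    refine intervalIntegral.integral_congr fun w hw ↦ ?_
    rw [uIcc_of_le hx.1] at hw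
    rw [windowIntegral_eq hw.1 hw.2 ht.1 ht.2, ← intervalIntegral.integral_ofReal]
    ring
  have hsplit : ∫ w in (0 : ℝ)..x, (K x w : ℂ) * e w =
      (∫ w in (0 : ℝ)..x, e w * ∫ t in (0 : ℝ)..(x - w), (V t : ℂ)) +
      ∫ w in (0 : ℝ)..x, e w * ∫ t in (0 : ℝ)..T, (V t : ℂ) * windowIntegral K x w t := by
    have hc1 : Continuous fun w ↦ e w * ∫ t in (0 : ℝ)..(x - w), (V t : ℂ) :=
      he.mul ((intervalIntegral.continuous_primitive (fun _ _ ↦ hVc.intervalIntegrable) 0).comp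
        (by fun_prop))
    have hpt : ∀ w ∈ Icc 0 x, (K x w : ℂ) * e w = e w * (∫ t in (0 : ℝ)..(x - w), (V t : ℂ)) +
        e w * ∫ t in (0 : ℝ)..T, (V t : ℂ) * windowIntegral K x w t := fun w hw ↦ by
      rw [heq x hx w ⟨hw.1, hw.2.trans hx.2⟩]
      push_cast [← intervalIntegral.integral_ofReal]
      ring
    -- By the kernel equation this integrand is a difference of two continuous functions.
    have hc2 : IntervalIntegrable
        (fun w ↦ e w * ∫ t in (0 : ℝ)..T, (V t : ℂ) * windowIntegral K x w t) volume 0 x := by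
      have hKx : Continuous fun w ↦ (K x w : ℂ) * e w := (Complex.continuous_ofReal.comp
        (hK.comp (by fun_prop : Continuous fun s : ℝ ↦ (x, s)))).mul he
      refine ((hKx.sub hc1).intervalIntegrable 0 x).congr fun w hw ↦ ?_
      rw [uIoc_of_le hx.1] at hw
      rw [Pi.sub_apply, hpt w ⟨hw.1.le, hw.2⟩, add_sub_cancel_left]
    rw [← intervalIntegral.integral_add (hc1.intervalIntegrable _ _) hc2]
    refine intervalIntegral.integral_congr fun w hw ↦ hpt w ?_
    rwa [uIcc_of_le hx.1] at hw
  have hDc : Continuous fun t ↦ ∫ r in (0 : ℝ)..(x - t), e r :=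
    (intervalIntegral.continuous_primitive (fun _ _ ↦ he.intervalIntegrable _ _) 0).comp
      (by fun_prop)
  have hmc := continuous_kernelAmplitude hK ξ
  have hm : ∀ t, ∫ s in (0 : ℝ)..t, (K t s : ℂ) * e s = kernelAmplitude K ξ t - 1 := fun t ↦ by
    simp [kernelAmplitude, e]
  rw [kernelAmplitude, hsplit, hK1, hK2, ← intervalIntegral.integral_add]
  · congr 2
    ext t
    rw [hm t]
    ring
  · exact hVc.intervalIntegrable.mul_continuousOn hDc.continuousOn
  · simp only [hm]
    exact hVc.intervalIntegrable.mul_continuousOn (hDc.mul (hmc.sub continuous_const)).continuousOn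

/-- For every potential there is a real transformation kernel `K`, independent of the energy, such
that the solution of `-ψ'' + V ψ = k² ψ` with `ψ(0) = 1`, `ψ'(0) = ik` is
`exp (ikx) (1 + ∫₀ˣ K(x, w) exp (-2ikw) dw)`. -/
lemma exists_solution_eq_kernelAmplitude {T : ℝ} (hT : 0 < T) {V : ℝ → ℝ} (hV : Integrable V)
    (hsupp : ∀ t ∉ Icc 0 T, V t = 0) :
    ∃ K : ℝ → ℝ → ℝ, Continuous (Function.uncurry K) ∧ (∃ C, ∀ x w, |K x w| ≤ C) ∧
      ∀ k : ℝ, ∃ ψ φ : ℝ → ℂ, IsSchrodingerSolution T V ((k : ℂ) ^ 2) ψ φ ∧ ψ 0 = 1 ∧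
        φ 0 = k * Complex.I ∧
        ∀ x ∈ Icc 0 T, ψ x = unitaryChar k x * kernelAmplitude K (-(2 * k)) x := by
  obtain ⟨K, hK, ⟨C, hC⟩, heq⟩ := exists_transformationKernel hT hV
  refine ⟨K, hK, ⟨C, hC⟩, fun k ↦ ?_⟩
  set m := kernelAmplitude K (-(2 * k)) with hm
  set e := unitaryChar (-(2 * k)) with he
  set c := unitaryChar k with hc
  have hmc : Continuous m := continuous_kernelAmplitude hK _
  have hec : Continuous e := continuous_unitaryChar _
  have hf : Integrable fun t ↦ (V t : ℂ) * m t * e (-t) := by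
    have h1 : IntegrableOn (fun t ↦ (V t : ℂ) * (m t * e (-t))) (Icc 0 T) :=
      hV.ofReal.integrableOn.mul_continuousOn (Continuous.continuousOn (by fun_prop)) isCompact_Icc
    simp only [← mul_assoc] at h1
    refine h1.integrable_of_forall_notMem_eq_zero fun t ht ↦ ?_
    simp [hsupp t ht]
  set f : ℝ → ℂ := fun t ↦ (V t : ℂ) * m t * e (-t) with hfdef
  -- With ψ = c m the equation becomes (exp(2ikx) m')' = exp(2ikx) V m, so `n` is the candidate for
  -- m'. Its primitive `M` is C¹ on the whole line and agrees with `m` on [0, T].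
  let n : ℝ → ℂ := fun y ↦ e y * (0 + ∫ t in (0 : ℝ)..y, f t)
  have hnc : Continuous n := hec.mul (continuous_const.add
    (intervalIntegral.continuous_primitive (fun _ _ ↦ hf.intervalIntegrable) 0))
  let M : ℝ → ℂ := fun x ↦ 1 + ∫ y in (0 : ℝ)..x, n y
  have hM : ∀ x, HasDerivAt M (n x) x := fun x ↦
    (hnc.integral_hasStrictDerivAt 0 x).hasDerivAt.const_add 1
  have hmM : ∀ x ∈ Icc 0 T, m x = M x := by
    intro x hx
    rw [hm, kernelAmplitude_eq hV hK hC heq _ hx]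
    simp only [M, n, zero_add]
    rw [← integral_mul_integral_triangle hf hec hx.1]
    congr 2
    ext t
    have h1 : ∫ r in (0 : ℝ)..(x - t), e r = e (-t) * ∫ y in t..x, e y := by
      rw [← intervalIntegral.integral_const_mul, ← sub_self t,
        ← intervalIntegral.integral_comp_sub_right]
      congr 1
      ext y
      rw [sub_eq_neg_add]
      exact unitaryChar_add _ _ _
    rw [h1]
    simp only [hfdef]
    ring
  have hMd : ContDiff ℝ 1 M := contDiff_one_of_hasDerivAt hnc hM
  have hac : ∀ g : ℝ → ℂ, ContDiff ℝ 1 g → AbsolutelyContinuousOnInterval g 0 T := fun g hg ↦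
    hg.contDiffOn.absolutelyContinuousOnInterval
  have hcd := hasDerivAt_unitaryChar k
  refine ⟨fun x ↦ c x * M x, fun x ↦ c x * (k * Complex.I * M x + n x), ⟨fun x _ ↦ ?_, ?_, ?_⟩,
    by simp [M, c], by simp [M, n, c], fun x hx ↦ by simp only [hmM x hx]⟩
  · refine (((hcd x).mul (hM x)).congr_deriv ?_).hasDerivWithinAt
    ring
  · have h1 : AbsolutelyContinuousOnInterval n 0 T :=
      (hac _ (contDiff_unitaryChar _)).fun_smul (absolutelyContinuous_primitive hf 0 T)
    exact (hac _ (contDiff_unitaryChar _)).fun_smul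
      ((hac _ (contDiff_const.mul hMd)).fun_add h1)
  · filter_upwards [LocallyIntegrable.ae_hasDerivAt_integral hf.locallyIntegrable] with x hx hxT
    have h1 : HasDerivAt n _ x := (hasDerivAt_unitaryChar (-(2 * k)) x).mul ((hx 0).const_add 0)
    refine ⟨_, (hcd x).mul (((hM x).const_mul (k * Complex.I)).add h1), ?_⟩
    have h2 := unitaryChar_mul_neg (-(2 * k)) x
    have h3 := hmM x ⟨hxT.1.le, hxT.2.le⟩
    simp only [hfdef, n, h3]
    push_cast
    linear_combination (-c x * V x * M x) * h2 + (-c x * k ^ 2 * M x) * Complex.I_sq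

/-! ### Green's identity. -/

/-- The derivative `φ` is absolutely continuous, hence bounded, so `ψ` is Lipschitz. -/
lemma IsSchrodingerSolution.absolutelyContinuous {T : ℝ} (hT : 0 ≤ T) {V : ℝ → ℝ} {E : ℂ}
    {ψ φ : ℝ → ℂ} (h : IsSchrodingerSolution T V E ψ φ) :
    AbsolutelyContinuousOnInterval ψ 0 T := by
  obtain ⟨C, hC⟩ := h.absCont.exists_bound
  have hC0 : 0 ≤ C := (norm_nonneg _).trans (hC 0 (by simp))
  refine LipschitzOnWith.absolutelyContinuousOnInterval (K := ⟨C, hC0⟩) ?_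
  rw [uIcc_of_le hT] at hC ⊢
  exact (convex_Icc 0 T).lipschitzOnWith_of_nnnorm_hasDerivWithin_le h.hasDeriv hC

/-- Used to pass from a potential cut off outside [0, T) back to the original one. -/
lemma IsSchrodingerSolution.congr_potential {T : ℝ} {V W : ℝ → ℝ} {E : ℂ} {ψ φ : ℝ → ℂ}
    (h : IsSchrodingerSolution T V E ψ φ) (hVW : EqOn V W (Ioo 0 T)) :
    IsSchrodingerSolution T W E ψ φ := by
  refine ⟨h.hasDeriv, h.absCont, ?_⟩
  filter_upwards [h.eqn] with x hx hxT
  rw [← hVW hxT]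
  exact hx hxT

/-- Green's identity for solutions with different potentials and the same energy. -/
lemma IsSchrodingerSolution.integral_sub_mul {T : ℝ} (hT : 0 ≤ T) {V₁ V₂ : ℝ → ℝ}
    (hV : Integrable fun x ↦ V₁ x - V₂ x) (hsupp : ∀ t ∉ Icc 0 T, V₁ t - V₂ t = 0) {E : ℂ}
    {ψ₁ φ₁ ψ₂ φ₂ : ℝ → ℂ} (h₁ : IsSchrodingerSolution T V₁ E ψ₁ φ₁)
    (h₂ : IsSchrodingerSolution T V₂ E ψ₂ φ₂) :
    ∫ x, ((V₁ x - V₂ x : ℝ) : ℂ) * (ψ₁ x * ψ₂ x) =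
      (φ₁ T * ψ₂ T - ψ₁ T * φ₂ T) - (φ₁ 0 * ψ₂ 0 - ψ₁ 0 * φ₂ 0) := by
  have hI : uIcc 0 T = Icc 0 T := uIcc_of_le hT
  have hc : ∀ {V ψ φ}, IsSchrodingerSolution T V E ψ φ → ContinuousOn ψ (Icc 0 T) :=
    fun h x hx ↦ (h.hasDeriv x hx).continuousWithinAt
  set f : ℝ → ℂ := fun x ↦ ((V₁ x - V₂ x : ℝ) : ℂ) * (ψ₁ x * ψ₂ x) with hf
  have hfs : ∀ x ∉ Icc 0 T, f x = 0 := fun x hx ↦ by simp only [hf, hsupp x hx]; simp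
  have hfi : Integrable f := IntegrableOn.integrable_of_forall_notMem_eq_zero
    (hV.ofReal.integrableOn.mul_continuousOn ((hc h₁).mul (hc h₂)) isCompact_Icc) hfs
  -- The function φ₁ψ₂ - ψ₁φ₂ has derivative (V₁ - V₂)ψ₁ψ₂ almost everywhere; minus the primitive of
  -- the latter, it is absolutely continuous with zero derivative, hence constant.
  have hac := ((h₁.absCont.fun_smul (h₂.absolutelyContinuous hT)).fun_sub
    ((h₁.absolutelyContinuous hT).fun_smul h₂.absCont)).fun_sub
      (absolutelyContinuous_primitive hfi 0 T)
  obtain ⟨C, hC⟩ := hac.const_of_ae_hasDerivAt_zero (by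
    have n0 : ∀ᵐ x : ℝ, x ≠ 0 := by simp [ae_iff, measure_singleton]
    have nT : ∀ᵐ x : ℝ, x ≠ T := by simp [ae_iff, measure_singleton]
    filter_upwards [h₁.eqn, h₂.eqn, n0, nT,
      LocallyIntegrable.ae_hasDerivAt_integral hfi.locallyIntegrable] with x e₁ e₂ hx0 hxT hfx hx
    rw [hI] at hx
    have hx' : x ∈ Ioo 0 T := ⟨lt_of_le_of_ne hx.1 hx0.symm, lt_of_le_of_ne hx.2 hxT⟩
    have hn : Icc 0 T ∈ nhds x := Icc_mem_nhds hx'.1 hx'.2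
    obtain ⟨d₁, hd₁, q₁⟩ := e₁ hx'
    obtain ⟨d₂, hd₂, q₂⟩ := e₂ hx'
    have p₁ := (h₁.hasDeriv x hx).hasDerivAt hn
    have p₂ := (h₂.hasDeriv x hx).hasDerivAt hn
    convert! ((hd₁.smul p₂).sub (p₁.smul hd₂)).sub ((hfx 0).const_add 0) using 1
    simp only [smul_eq_mul, hf]
    push_cast
    linear_combination (-ψ₁ x) * q₂ + ψ₂ x * q₁)
  have h0 := (hC T (by simp)).trans (hC 0 (by simp)).symm
  have hint : ∫ x, f x = ∫ x in (0 : ℝ)..T, f x := by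
    rw [intervalIntegral.integral_of_le hT, ← integral_Icc_eq_integral_Ioc,
      setIntegral_eq_integral_of_forall_compl_eq_zero hfs]
  simp only [smul_eq_mul, intervalIntegral.integral_same] at h0
  rw [hint]
  linear_combination -h0

/-! ### Products of kernel amplitudes. -/

/-- A kernel cut off to the triangle `0 < s ≤ x ≤ T`. -/
noncomputable def cutoffKernel (T : ℝ) (K : ℝ → ℝ → ℝ) (x s : ℝ) : ℝ :=
  {p : ℝ × ℝ | 0 < p.2 ∧ p.2 ≤ p.1 ∧ p.1 ≤ T}.indicator (Function.uncurry K) (x, s)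

lemma measurable_cutoffKernel (T : ℝ) {K : ℝ → ℝ → ℝ} (hK : Continuous (Function.uncurry K)) :
    Measurable fun p : ℝ × ℝ ↦ cutoffKernel T K p.1 p.2 :=
  hK.measurable.indicator ((measurableSet_lt measurable_const measurable_snd).inter
    ((measurableSet_le measurable_snd measurable_fst).inter
      (measurableSet_le measurable_fst measurable_const)))

lemma cutoffKernel_eq_zero {T : ℝ} {K : ℝ → ℝ → ℝ} {x s : ℝ} (hs : s ∉ Ioc 0 T) :
    cutoffKernel T K x s = 0 :=
  indicator_of_notMem (fun h ↦ hs ⟨h.1, h.2.1.trans h.2.2⟩) _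

lemma abs_cutoffKernel_le {T C : ℝ} {K : ℝ → ℝ → ℝ} (hC : ∀ x s, |K x s| ≤ C) (x s : ℝ) :
    |cutoffKernel T K x s| ≤ C := by
  rw [cutoffKernel, indicator_apply]
  split_ifs
  · exact hC x s
  · simpa using (abs_nonneg _).trans (hC 0 0)

lemma integrable_cutoffKernel (T : ℝ) {C : ℝ} {K : ℝ → ℝ → ℝ}
    (hK : Continuous (Function.uncurry K)) (hC : ∀ x s, |K x s| ≤ C) (x : ℝ) :
    Integrable (cutoffKernel T K x) := by
  have h1 : Integrable ((Ioc 0 T).indicator fun _ ↦ C) :=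
    (integrableOn_const (by simp)).integrable_indicator measurableSet_Ioc
  refine h1.mono' ((measurable_cutoffKernel T hK).comp
    measurable_prodMk_left).aestronglyMeasurable (.of_forall fun s ↦ ?_)
  by_cases hs : s ∈ Ioc 0 T
  · rw [indicator_of_mem hs]
    exact abs_cutoffKernel_le hC x s
  · rw [indicator_of_notMem hs, cutoffKernel_eq_zero hs, norm_zero]

lemma integrable_mul_unitaryChar {f : ℝ → ℝ} (hf : Integrable f) (ξ : ℝ) :
    Integrable fun s ↦ (f s : ℂ) * unitaryChar ξ s :=
  hf.ofReal.mul_bdd (c := 1) (continuous_unitaryChar ξ).aestronglyMeasurable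
    (.of_forall fun s ↦ (norm_unitaryChar ξ s).le)

/-- Replaces the moving interval [0, x] by the whole line, where products of Fourier integrals
become convolutions. -/
lemma kernelAmplitude_eq_integral_cutoffKernel {T : ℝ} (K : ℝ → ℝ → ℝ) (ξ : ℝ) {x : ℝ}
    (hx : x ∈ Icc 0 T) :
    kernelAmplitude K ξ x = 1 + ∫ s, (cutoffKernel T K x s : ℂ) * unitaryChar ξ s := by
  rw [kernelAmplitude, intervalIntegral.integral_of_le hx.1,
    ← integral_indicator measurableSet_Ioc]
  congr 2
  ext s
  by_cases hs : s ∈ Ioc 0 x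
  · have h1 : (x, s) ∈ {p : ℝ × ℝ | 0 < p.2 ∧ p.2 ≤ p.1 ∧ p.1 ≤ T} := ⟨hs.1, hs.2, hx.2⟩
    rw [indicator_of_mem hs, cutoffKernel, indicator_of_mem h1]
    rfl
  · have h1 : (x, s) ∉ {p : ℝ × ℝ | 0 < p.2 ∧ p.2 ≤ p.1 ∧ p.1 ≤ T} := fun h ↦ hs ⟨h.1, h.2.1⟩
    rw [indicator_of_notMem hs, cutoffKernel, indicator_of_notMem h1]
    simp

/-- The kernel of the product of two kernel amplitudes. -/
noncomputable def productKernel (T : ℝ) (K₁ K₂ : ℝ → ℝ → ℝ) (x w : ℝ) : ℝ :=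
  cutoffKernel T K₁ x w + cutoffKernel T K₂ x w +
    ∫ s, cutoffKernel T K₁ x s * cutoffKernel T K₂ x (w - s)

/-- Supports add under convolution. Vanishing for w ≤ 0 is what later makes the equation for the
difference of potentials a Volterra equation. -/
lemma productKernel_eq_zero {T : ℝ} {K₁ K₂ : ℝ → ℝ → ℝ} {x w : ℝ} (hw : w ∉ Ioc 0 (2 * T)) :
    productKernel T K₁ K₂ x w = 0 := by
  have h1 : w ∉ Ioc 0 T := fun h ↦ hw ⟨h.1, by linarith [h.1, h.2]⟩
  have h2 : ∀ s, cutoffKernel T K₁ x s * cutoffKernel T K₂ x (w - s) = 0 := fun s ↦ by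
    by_cases hs : s ∈ Ioc 0 T
    · have h3 : w - s ∉ Ioc 0 T := fun h ↦ hw ⟨by linarith [h.1, hs.1], by linarith [h.2, hs.2]⟩
      rw [cutoffKernel_eq_zero h3, mul_zero]
    · rw [cutoffKernel_eq_zero hs, zero_mul]
  simp [productKernel, cutoffKernel_eq_zero h1, h2]

section productKernel

variable {K₁ K₂ : ℝ → ℝ → ℝ}

lemma measurable_productKernel (T : ℝ) (h₁ : Continuous (Function.uncurry K₁))
    (h₂ : Continuous (Function.uncurry K₂)) :
    Measurable fun p : ℝ × ℝ ↦ productKernel T K₁ K₂ p.1 p.2 := by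
  have m1 := measurable_cutoffKernel T h₁
  have m2 := measurable_cutoffKernel T h₂
  refine (m1.add m2).add (StronglyMeasurable.measurable ?_)
  refine StronglyMeasurable.integral_prod_right
    (f := fun (p : ℝ × ℝ) s ↦ cutoffKernel T K₁ p.1 s * cutoffKernel T K₂ p.1 (p.2 - s)) ?_
  refine Measurable.stronglyMeasurable (Measurable.mul
    (m1.comp (by fun_prop : Measurable fun p : (ℝ × ℝ) × ℝ ↦ (p.1.1, p.2)))
    (m2.comp (by fun_prop : Measurable fun p : (ℝ × ℝ) × ℝ ↦ (p.1.1, p.1.2 - p.2))))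

lemma exists_abs_productKernel_le (T : ℝ) {C₁ C₂ : ℝ} (hC₁ : ∀ x s, |K₁ x s| ≤ C₁) (hC₂ : ∀ x s, |K₂ x s| ≤ C₂) :
    ∃ C, ∀ x w, |productKernel T K₁ K₂ x w| ≤ C := by
  have hC₁0 : 0 ≤ C₁ := (abs_nonneg _).trans (hC₁ 0 0)
  have hC₂0 : 0 ≤ C₂ := (abs_nonneg _).trans (hC₂ 0 0)
  refine ⟨C₁ + C₂ + C₁ * C₂ * volume.real (Ioc 0 T), fun x w ↦ ?_⟩
  refine (abs_add_le _ _).trans (add_le_add ((abs_add_le _ _).trans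
    (add_le_add (abs_cutoffKernel_le hC₁ x w) (abs_cutoffKernel_le hC₂ x w))) ?_)
  rw [← setIntegral_eq_integral_of_forall_compl_eq_zero (s := Ioc 0 T)
    fun s hs ↦ by rw [cutoffKernel_eq_zero hs, zero_mul], ← Real.norm_eq_abs]
  refine norm_setIntegral_le_of_norm_le_const measure_Ioc_lt_top fun s _ ↦ ?_
  rw [norm_mul]
  exact mul_le_mul (abs_cutoffKernel_le hC₁ x s) (abs_cutoffKernel_le hC₂ x _) (abs_nonneg _) hC₁0

/-- The integral of a convolution is the product of the integrals, and the character leaves the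
convolution because its values at s and w - s multiply to its value at w. -/
lemma kernelAmplitude_mul {T C₁ C₂ : ℝ} (h₁ : Continuous (Function.uncurry K₁))
    (h₂ : Continuous (Function.uncurry K₂))
    (hC₁ : ∀ x s, |K₁ x s| ≤ C₁) (hC₂ : ∀ x s, |K₂ x s| ≤ C₂) (ξ : ℝ) {x : ℝ}
    (hx : x ∈ Icc 0 T) :
    kernelAmplitude K₁ ξ x * kernelAmplitude K₂ ξ x =
      1 + ∫ w, (productKernel T K₁ K₂ x w : ℂ) * unitaryChar ξ w := by
  have i1 := integrable_mul_unitaryChar (integrable_cutoffKernel T h₁ hC₁ x) ξ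
  have i2 := integrable_mul_unitaryChar (integrable_cutoffKernel T h₂ hC₂ x) ξ
  have h3 := integral_convolution (ContinuousLinearMap.mul ℂ ℂ) i1 i2
  have i3 := i1.integrable_convolution (ContinuousLinearMap.mul ℂ ℂ) i2
  have h4 : convolution (fun s ↦ (cutoffKernel T K₁ x s : ℂ) * unitaryChar ξ s)
      (fun s ↦ (cutoffKernel T K₂ x s : ℂ) * unitaryChar ξ s) (ContinuousLinearMap.mul ℂ ℂ)
      volume = fun w ↦ ((∫ s, cutoffKernel T K₁ x s * cutoffKernel T K₂ x (w - s) : ℝ) : ℂ) *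
        unitaryChar ξ w := by
    ext w
    rw [convolution_def, ← integral_complex_ofReal, ← integral_mul_const]
    congr 1
    ext s
    have h5 := unitaryChar_add ξ s (w - s)
    rw [add_sub_cancel] at h5
    rw [ContinuousLinearMap.mul_apply', h5]
    push_cast
    ring
  rw [h4] at h3 i3
  rw [ContinuousLinearMap.mul_apply'] at h3
  simp only [productKernel, Complex.ofReal_add, add_mul]
  have h5 := integral_add (i1.add i2) i3
  simp only [Pi.add_apply] at h5
  rw [h5, integral_add i1 i2, h3,
    kernelAmplitude_eq_integral_cutoffKernel K₁ ξ hx,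
    kernelAmplitude_eq_integral_cutoffKernel K₂ ξ hx]
  ring

end productKernel

/-! ### Completeness and the conclusion. -/

/-- Completeness of functions that are Volterra perturbations of the characters: if `q` is
supported on `[0, T]` and orthogonal to all of them, then `q = 0`. -/
lemma ae_eq_zero_of_forall_integral_perturbed_char_eq_zero {T C : ℝ} (hT : 0 ≤ T) {q : ℝ → ℝ}
    (hq : Integrable q) (hsupp : ∀ t ∉ Icc 0 T, q t = 0) {L : ℝ → ℝ → ℝ}
    (hL : Measurable fun p : ℝ × ℝ ↦ L p.1 p.2) (hC : ∀ x w, |L x w| ≤ C)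
    (hL0 : ∀ x, ∀ w ∉ Ioc 0 (2 * T), L x w = 0)
    (h0 : ∀ η : ℝ, ∫ x, (q x : ℂ) * (unitaryChar η x *
      (1 + ∫ w, (L x w : ℂ) * unitaryChar (-η) w)) = 0) :
    ∀ᵐ u, u ∈ Ioc 0 T → q u = 0 := by
  have hC0 : 0 ≤ C := (abs_nonneg _).trans (hC 0 0)
  -- For x in [0, T] the factor L(x, x - u) is bounded and vanishes unless u lies in [-2T, T], which
  -- yields an integrable majorant.
  have hF : Integrable (fun p : ℝ × ℝ ↦ q p.1 * L p.1 (p.1 - p.2)) (volume.prod volume) := by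
    have h1 : Integrable ((Icc (-(2 * T)) T).indicator fun _ ↦ C) :=
      (integrableOn_const (by simp)).integrable_indicator measurableSet_Icc
    refine (hq.abs.mul_prod h1).mono' (hq.aestronglyMeasurable.comp_fst.mul
      (hL.comp (by fun_prop : Measurable fun p : ℝ × ℝ ↦ (p.1, p.1 - p.2))).aestronglyMeasurable)
      (.of_forall fun ⟨x, u⟩ ↦ ?_)
    simp only
    rw [norm_mul, Real.norm_eq_abs]
    by_cases hx : x ∈ Icc 0 T
    · refine mul_le_mul_of_nonneg_left ?_ (abs_nonneg _)
      by_cases hu : u ∈ Icc (-(2 * T)) T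
      · rw [indicator_of_mem hu]
        exact hC _ _
      · rw [hL0 x (x - u) fun h ↦ hu ⟨by linarith [h.2, hx.1], by linarith [h.1, hx.2]⟩, norm_zero]
        exact indicator_nonneg (fun _ _ ↦ hC0) u
    · simp [hsupp x hx]
  have hg : Integrable fun u ↦ ∫ x, q x * L x (x - u) := hF.integral_prod_right
  have hFT : ∀ η : ℝ, ∫ u, ((q u + ∫ x, q x * L x (x - u) : ℝ) : ℂ) * unitaryChar η u = 0 := by
    intro η
    have hFη : Integrable (Function.uncurry fun x u ↦
        ((q x * L x (x - u) : ℝ) : ℂ) * unitaryChar η u) (volume.prod volume) :=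
      hF.ofReal.mul_bdd (c := 1) ((continuous_unitaryChar η).comp
        continuous_snd).aestronglyMeasurable (.of_forall fun p ↦ (norm_unitaryChar η p.2).le)
    have hinner : ∀ x, (q x : ℂ) * (unitaryChar η x *
        (1 + ∫ w, (L x w : ℂ) * unitaryChar (-η) w)) = (q x : ℂ) * unitaryChar η x +
        ∫ u, ((q x * L x (x - u) : ℝ) : ℂ) * unitaryChar η u := fun x ↦ by
      rw [mul_add, mul_one, mul_add, ← integral_const_mul, ← integral_const_mul,
        ← integral_sub_left_eq_self _ _ x]
      congr 2
      ext u
      have h1 : unitaryChar η x * unitaryChar (-η) (x - u) = unitaryChar η u := by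
        simp only [unitaryChar, ← Complex.exp_add]
        push_cast
        ring_nf
      rw [← h1]
      push_cast
      ring
    have h2 := h0 η
    simp only [hinner] at h2
    have h3 := integral_add (integrable_mul_unitaryChar hq η) hFη.integral_prod_left
    simp only [Function.uncurry] at h3
    rw [h3, integral_integral_swap hFη] at h2
    simp only [Complex.ofReal_add, add_mul]
    rw [integral_add (integrable_mul_unitaryChar hq η) (integrable_mul_unitaryChar hg η), ← h2]
    congr 2
    ext u
    rw [integral_mul_const, integral_complex_ofReal]
  have hae := ae_eq_zero_of_forall_integral_exp_eq_zero (hq.add hg) fun η ↦ by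
    simpa [unitaryChar] using hFT η
  -- `C` may be zero, whereas the Gronwall constant must be positive.
  refine ae_eq_zero_of_le_integral (C := C + 1) hq hT (by positivity) ?_
  filter_upwards [hae] with u hu huT
  have h1 : q u = -∫ x, q x * L x (x - u) := eq_neg_of_add_eq_zero_left hu
  have h2 : ∫ x, q x * L x (x - u) = ∫ x in u..T, q x * L x (x - u) := by
    rw [intervalIntegral.integral_of_le huT.2, setIntegral_eq_integral_of_forall_compl_eq_zero]
    intro x hx
    by_cases hxT : x ≤ T
    · have hxu : x ≤ u := by
        by_contra h
        exact hx ⟨not_le.1 h, hxT⟩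
      rw [hL0 x (x - u) fun h ↦ by linarith [h.1], mul_zero]
    · rw [hsupp x fun h ↦ hxT h.2, zero_mul]
  rw [h1, abs_neg, h2, ← intervalIntegral.integral_const_mul, ← Real.norm_eq_abs]
  refine intervalIntegral.norm_integral_le_of_norm_le huT.2 (.of_forall fun x _ ↦ ?_)
    (hq.abs.const_mul _).intervalIntegrable
  rw [norm_mul, mul_comm, Real.norm_eq_abs, Real.norm_eq_abs]
  exact mul_le_mul_of_nonneg_right ((hC _ _).trans (by linarith)) (abs_nonneg _)

theorem lemma2p6 (T : ℝ) (hT : 0 < T) (V₁ V₂ : ℝ → ℝ)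
    (hV₁ : MemLp V₁ 2 (volume.restrict (Ico 0 T)))
    (hV₂ : MemLp V₂ 2 (volume.restrict (Ico 0 T)))
    (hA : ∀ E : ℂ, transferMatrix hT hV₁ E = transferMatrix hT hV₂ E) :
    V₁ =ᵐ[volume.restrict (Ico 0 T)] V₂ := by
  have hint : ∀ {V : ℝ → ℝ}, MemLp V 2 (volume.restrict (Ico 0 T)) →
      Integrable ((Ico 0 T).indicator V) := fun hV ↦
    (integrable_indicator_iff measurableSet_Ico).2 (hV.integrable (by norm_num))
  have hsupp : ∀ (V : ℝ → ℝ), ∀ t ∉ Icc 0 T, (Ico 0 T).indicator V t = 0 := fun V t ht ↦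
    indicator_of_notMem (fun h ↦ ht ⟨h.1, h.2.le⟩) _
  have hind : ∀ V : ℝ → ℝ, EqOn ((Ico 0 T).indicator V) V (Ioo 0 T) := fun V t ht ↦
    indicator_of_mem (show t ∈ Ico 0 T from ⟨ht.1.le, ht.2⟩) _
  obtain ⟨K₁, hK₁, ⟨C₁, hC₁⟩, hsol₁⟩ :=
    exists_solution_eq_kernelAmplitude hT (hint hV₁) (hsupp V₁)
  obtain ⟨K₂, hK₂, ⟨C₂, hC₂⟩, hsol₂⟩ :=
    exists_solution_eq_kernelAmplitude hT (hint hV₂) (hsupp V₂)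
  obtain ⟨C, hC⟩ := exists_abs_productKernel_le T hC₁ hC₂
  have hqi := (hint hV₁).sub (hint hV₂)
  have hqs : ∀ t ∉ Icc 0 T, (Ico 0 T).indicator V₁ t - (Ico 0 T).indicator V₂ t = 0 :=
    fun t ht ↦ by rw [hsupp V₁ t ht, hsupp V₂ t ht, sub_zero]
  have hq0 := ae_eq_zero_of_forall_integral_perturbed_char_eq_zero hT.le hqi hqs
    (measurable_productKernel T hK₁ hK₂) hC (fun x w hw ↦ productKernel_eq_zero hw) fun η ↦ by
      obtain ⟨ψ₁, φ₁, s₁, a₁, b₁, f₁⟩ := hsol₁ (η / 2)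
      -- The product of two solutions with wave number k oscillates at frequency 2k, so k = η / 2.
      obtain ⟨ψ₂, φ₂, s₂, a₂, b₂, f₂⟩ := hsol₂ (η / 2)
      have t₁ := (existsUnique_isTransferMatrix hT hV₁ _).choose_spec.1 ψ₁ φ₁
        (s₁.congr_potential (hind V₁))
      have t₂ := (existsUnique_isTransferMatrix hT hV₂ _).choose_spec.1 ψ₂ φ₂
        (s₂.congr_potential (hind V₂))
      have hAE := hA (((η / 2 : ℝ) : ℂ) ^ 2)
      unfold transferMatrix at hAE
      rw [a₁, b₁, hAE] at t₁
      rw [a₂, b₂, ← t₁] at t₂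
      have tψ : ψ₂ T = ψ₁ T := congrFun t₂ 0
      have tφ : φ₂ T = φ₁ T := congrFun t₂ 1
      have hW := s₁.integral_sub_mul hT.le hqi hqs s₂
      -- With equal Cauchy data at both ends, each boundary term is a Wronskian of a pair with
      -- itself.
      rw [tψ, tφ, a₁, b₁, a₂, b₂] at hW
      rw [← sub_self (φ₁ T * ψ₁ T - ψ₁ T * φ₁ T)]
      refine Eq.trans ?_ (hW.trans (by ring))
      congr 1
      ext x
      by_cases hx : x ∈ Icc 0 T
      · rw [f₁ x hx, f₂ x hx, mul_div_cancel₀ _ (two_ne_zero' ℝ),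
          ← kernelAmplitude_mul hK₁ hK₂ hC₁ hC₂ (-η) hx]
        have h1 : unitaryChar η x = unitaryChar (η / 2) x * unitaryChar (η / 2) x := by
          simp only [unitaryChar, ← Complex.exp_add]
          push_cast
          ring_nf
        rw [h1, Pi.sub_apply]
        ring
      · rw [Pi.sub_apply, hqs x hx]
        simp
  rw [Filter.EventuallyEq, ae_restrict_iff' measurableSet_Ico]
  have n0 : ∀ᵐ x : ℝ, x ≠ 0 := by simp [ae_iff, measure_singleton]
  filter_upwards [hq0, n0] with x hx hx0 hxT
  have h1 := hx ⟨lt_of_le_of_ne hxT.1 hx0.symm, hxT.2.le⟩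
  rw [Pi.sub_apply, indicator_of_mem hxT, indicator_of_mem hxT] at h1
  exact sub_eq_zero.1 h1
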